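/- A UAV serves $U$ users, one at a time. From a position $x$ (its starting position, or the place where it has served some user) it is at distance $d_i(x)\ge 0$ from user $i$ and flies to user $i$ in time $t^{\rm F}_i=d_i/c_{\rm U}$, $c_{\rm U}>0$; the transmission to user $i$ takes time $t^{\rm T}_i\ge 0$, an arbitrary function of the distance $d_i$ depending on $i$; and user $i$ has endurance time $T_i$. The state is $s=[w,v,t^{\rm S},t^{\rm F}]$, where $w_i\in\{0,1\}$ says whether user $i$ has been served, $v_i=T_i$, $t^{\rm S}_i$ is the time at which the UAV started to fly to user $i$ ($0$ if user $i$ has not been served), and $t^{\rm F}_i$ is the flying time to user $i$ (from the present position if user $i$ has not been served, otherwise the one that was needed). The flight to the next user starts when the previous service ends (at time $0$ for the first user). The actions are the users $a\in\{1,\dots,U\}$. Action $a$ serves user $a$ if this user has not been served and its total service time $t^{\rm S}_a+t^{\rm F}_a+t^{\rm T}_a$ is at most $T_a$; otherwise it leaves the state unchanged. The reward is $r(s,a)=\sum_i w_i$, the number of satisfied users. The states reachable from the initial state form a finite set $\mathcal S$, so this is a finite Markov decision process, with transition probabilities $p(s'\mid s,a)$ equal to $1$ if $s'$ is the resulting state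 and to $0$ otherwise. Let $0\le\gamma<1$ and $0\le\varepsilon\le1$. The double Q-learning algorithm starts from arbitrary tables $Q^A,Q^B:\mathcal S\times\{1,\dots,U\}\to\mathbb R$ and from the initial state. At each epoch $t$, in state $s$, with probability $\varepsilon$ (given the past) it explores: it takes a uniformly random action, and updates either of the tables. Otherwise it chooses one of the tables to update, in any way (for example in turn or at random), and takes an action that maximizes the other table at $s$. With $a$ the action taken, $s'$ the state it leads to, and $\alpha_t\in[0,1]$ the learning rate, the update of $Q^A$ is $$Q^A(s,a)\leftarrow(1-\alpha_t)Q^A(s,a)+\alpha_t\bigl(r(s,a)+\gamma Q^B(s',a^*)\bigr),\qquad a^*\in\arg\max_{a'}Q^A(s',a'),$$ that of $Q^B$ is the same with $A$ and $B$ exchanged, and nothing else in the tables changes. The algorithm then continues from $s'$, or, if a run of the UAV ends at this epoch, from the initial state, keeping the tables. Then there is exactly one function $Q^*$ on $\mathcal S\times\{1,\dots,U\}$ that satisfies Bellman's optimality equation $$Q^*(s,a)=\sum_{s'}p(s'\mid s,a)\bigl(r(s,a)+\gamma\max_{a'}Q^*(s',a')\bigr),$$ and the following holds. 1. If, with probability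 one, the learning rates used in the updates of each entry of each of the two tables have an infinite sum (for a constant learning rate $\alpha\in(0,1]$: if each entry of each table is updated infinitely often), then with probability one both $Q^A$ and $Q^B$ converge to $Q^*$ in every entry. 2. The condition in 1 holds, and hence both tables converge to $Q^*$ with probability one, if the learning rate is a constant $\alpha\in(0,1]$, $\varepsilon>0$, in exploration steps the table to be updated is chosen by a fair coin independent of the past and of the action, and every run consists of exactly $L$ epochs for some $L>U$. -/

import Mathlib

open MeasureTheory ProbabilityTheory Filter Topology

noncomputable section

/-! ## Finite Markov decision processes and the Bellman optimality equation -/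

/-- A finite Markov decision process: transition probabilities `p s a s'` and rewards `r s a`. -/
structure FiniteMDP (S A : Type*) [Fintype S] where
  p : S → A → S → ℝ
  r : S → A → ℝ
  p_nonneg : ∀ s a s', 0 ≤ p s a s'
  p_sum : ∀ s a, ∑ s', p s a s' = 1

/-- `Q` solves the Bellman optimality equation
`Q(s,a) = ∑ₛ' p(s,a,s') (r(s,a) + γ maxₐ' Q(s',a'))`. -/
def FiniteMDP.IsBellmanOptimal {S A : Type*} [Fintype S] (M : FiniteMDP S A) (γ : ℝ)
    (Q : S → A → ℝ) : Prop :=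
  ∀ s a, Q s a = ∑ s', M.p s a s' * (M.r s a + γ * ⨆ a', Q s' a')

/-- `a` is a maximizer of `Q s ·` (ties may be broken in any way). -/
def IsArgmax {S A : Type*} (Q : S → A → ℝ) (s : S) (a : A) : Prop :=
  ∀ a', Q s a' ≤ Q s a

/-! ## The UAV network and its decision process -/

/-- The data of a network with `U` users and one UAV. A position of the UAV is `none` (the
designated starting position) or `some j` (where it is after having served user `j`).
Transmission delays are arbitrary nonnegative functions of the distance, one for each user
(ground and aerial users may have different ones). -/
structure Network (U : ℕ) where
  /-- distance from a position of the UAV to a user -/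
  dist : Option (Fin U) → Fin U → ℝ
  /-- speed of the UAV -/
  speed : ℝ
  /-- transmission delay of a user, as a function of its distance -/
  trans : Fin U → ℝ → ℝ
  /-- endurance time of a user -/
  endurance : Fin U → ℝ
  dist_nonneg : ∀ x i, 0 ≤ dist x i
  speed_pos : 0 < speed
  trans_nonneg : ∀ i d, 0 ≤ d → 0 ≤ trans i d

/-- A state `[w, v, tS, tF]` of the UAV. -/
@[ext] structure UAVState (U : ℕ) where
  /-- `w i` : user `i` has been served (within its endurance time) -/
  w : Fin U → Bool
  /-- endurance times -/
  v : Fin U → ℝ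
  /-- time at which the UAV started to fly to user `i`; `0` if `i` has not been served -/
  tS : Fin U → ℝ
  /-- flying time: the one that was needed if `i` has been served, otherwise the one from
  the present position of the UAV -/
  tF : Fin U → ℝ

namespace Network

variable {U : ℕ} (N : Network U)

/-- Transmission delay of user `i` in state `s`; the distance is speed times flying time. -/
def tT (s : UAVState U) (i : Fin U) : ℝ := N.trans i (N.speed * s.tF i)

/-- Total service time `tS + tF + tT` of the user served last, that is, the present time
(`0` if no user has been served). -/
def clock (s : UAVState U) : ℝ :=
  ⨆ i, if s.w i then s.tS i + s.tF i + N.tT s i else 0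

/-- User `a` has not been served yet and is satisfied if the UAV serves it next. -/
def CanServe (s : UAVState U) (a : Fin U) : Prop :=
  s.w a = false ∧ N.clock s + s.tF a + N.tT s a ≤ s.v a

/-- The initial state. -/
def init : UAVState U where
  w := fun _ => false
  v := N.endurance
  tS := fun _ => 0
  tF := fun i => N.dist none i / N.speed

/-- The state after user `a` has been served. -/
def serve (s : UAVState U) (a : Fin U) : UAVState U where
  w := Function.update s.w a true
  v := s.v
  tS := Function.update s.tS a (N.clock s)
  tF := fun i => if i = a ∨ s.w i then s.tF i else N.dist (some a) i / N.speed

open Classical in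
/-- Taking action `a` (serve user `a`) in state `s`. Nothing happens if user `a` has already been
served or cannot be served within its endurance time. -/
def step (s : UAVState U) (a : Fin U) : UAVState U :=
  if N.CanServe s a then N.serve s a else s

/-- The states that can occur. -/
inductive Reachable : UAVState U → Prop
  | init : Reachable N.init
  | step (s : UAVState U) (a : Fin U) : Reachable s → Reachable (N.step s a)

/-- The state space of the decision process. -/
abbrev State : Type := {s : UAVState U // N.Reachable s}

theorem Reachable.exists_list {s : UAVState U} (h : N.Reachable s) :
    ∃ l : List (Fin U), l.length = (Finset.univ.filter fun i => s.w i = true).card ∧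
      l.foldl N.step N.init = s := by
  classical
  induction h with
  | init => exact ⟨[], by simp [Network.init], rfl⟩
  | step s a _ ih =>
    obtain ⟨l, hl, hs⟩ := ih
    by_cases hc : N.CanServe s a
    · refine ⟨l ++ [a], ?_, by simp [hs]⟩
      have : (Finset.univ.filter fun i => (N.step s a).w i = true)
          = insert a (Finset.univ.filter fun i => s.w i = true) := by
        ext i
        simp only [Network.step, if_pos hc, Network.serve, Finset.mem_filter, Finset.mem_univ,
          true_and, Finset.mem_insert, Function.update_apply]
        by_cases hi : i = a <;> simp [hi]
      rw [this, Finset.card_insert_of_notMem (by simp [hc.1])]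
      simp [hl]
    · have : N.step s a = s := if_neg hc
      exact ⟨l, by rw [this, hl], by rw [this, hs]⟩

instance : Finite N.State := by
  have hfin : {l : List (Fin U) | l.length ≤ U}.Finite := List.finite_length_le _ _
  have := hfin.image (fun l => l.foldl N.step N.init)
  refine (this.subset ?_ : {s | N.Reachable s}.Finite).to_subtype
  intro s hs
  obtain ⟨l, hl, h⟩ := Reachable.exists_list N hs
  refine ⟨l, ?_, h⟩
  have := Finset.card_le_univ (Finset.univ.filter fun i => s.w i = true)
  simp only [Fintype.card_fin] at this
  simpa [hl] using this

instance : Fintype N.State := Fintype.ofFinite _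

/-- The initial state, as an element of the state space. -/
def start : N.State := ⟨N.init, .init⟩

/-- The next state after taking action `a` in state `s`. -/
def next (s : N.State) (a : Fin U) : N.State := ⟨N.step s.1 a, .step s.1 a s.2⟩

open Classical in
/-- The decision process of the UAV: the action decides the next state, and the reward is the
number of satisfied users `∑ᵢ wᵢ`. -/
def mdp : FiniteMDP N.State (Fin U) where
  p := fun s a s' => if s' = N.next s a then 1 else 0
  r := fun s _ => ∑ i, if s.1.w i then 1 else 0
  p_nonneg := fun s a s' => by split_ifs <;> norm_num
  p_sum := fun s a => by simp

end Network

/-! ## Double Q-learning -/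

/-- The two Q-tables. -/
inductive Table
  | A
  | B

/-- The other table. -/
def Table.other : Table → Table
  | .A => .B
  | .B => .A

/-- An execution of the double Q-learning algorithm for the network `N` with discount factor `γ`
and exploration probability `ε`, on a probability space with measure `μ`. The time index counts
decision epochs; it goes through successive runs of the UAV, each of which begins in the initial
state, and both tables are kept from one run to the next. -/
structure DoubleQLearning {U : ℕ} (N : Network U) (γ ε : ℝ) {Ω : Type*} [MeasurableSpace Ω]
    (μ : Measure Ω) where
  /-- the information available before epoch `t` -/
  ℱ : Filtration ℕ (inferInstance : MeasurableSpace Ω)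
  /-- the Q-tables -/
  Q : Table → ℕ → Ω → N.State → Fin U → ℝ
  /-- the state of the UAV -/
  state : ℕ → Ω → N.State
  /-- the action taken -/
  action : ℕ → Ω → Fin U
  /-- whether the epoch is an exploration step -/
  explore : ℕ → Ω → Prop
  /-- the table that is updated; it may be chosen in any way, in turn or at random for example -/
  table : ℕ → Ω → Table
  /-- the learning rate -/
  rate : ℕ → Ω → ℝ
  /-- whether the epoch is the last one of a run -/
  last : ℕ → Ω → Prop
  measurable_Q : ∀ b t s a, Measurable[ℱ t] fun ω => Q b t ω s a
  measurable_state : ∀ t s, MeasurableSet[ℱ t] {ω | state t ω = s}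
  measurable_action : ∀ t a, MeasurableSet[ℱ (t + 1)] {ω | action t ω = a}
  measurable_explore : ∀ t, MeasurableSet[ℱ (t + 1)] {ω | explore t ω}
  measurable_table : ∀ t b, MeasurableSet[ℱ (t + 1)] {ω | table t ω = b}
  measurable_rate : ∀ t, Measurable[ℱ (t + 1)] (rate t)
  measurable_last : ∀ t, MeasurableSet[ℱ (t + 1)] {ω | last t ω}
  rate_mem : ∀ t ω, rate t ω ∈ Set.Icc (0 : ℝ) 1
  /-- the first run begins in the initial state -/
  state_zero : ∀ ω, state 0 ω = N.start
  /-- within a run, the action leads to the next state -/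
  state_succ : ∀ t ω, ¬ last t ω → state (t + 1) ω = N.next (state t ω) (action t ω)
  /-- a new run begins in the initial state -/
  state_last : ∀ t ω, last t ω → state (t + 1) ω = N.start
  /-- with probability `ε` the UAV explores, choosing one of the `U` actions uniformly -/
  explore_uniform : ∀ t a,
    μ[{ω | explore t ω ∧ action t ω = a}.indicator (fun _ => (1 : ℝ)) | ℱ t]
      =ᵐ[μ] fun _ => ε / U
  /-- otherwise it takes a best action according to the table that is not updated -/
  exploit_greedy : ∀ t ω, ¬ explore t ω →
    IsArgmax (Q (table t ω).other t ω) (state t ω) (action t ω)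
  /-- the update of the chosen table `b` at the present state and action:
  `Qᵇ(s,a) ← (1 - α) Qᵇ(s,a) + α (r(s,a) + γ Qᶜ(s',a*))`, where `c` is the other table, `s'` the
  next state and `a*` a maximizer of `Qᵇ(s',·)` -/
  update : ∀ t ω, ∃ a',
    IsArgmax (Q (table t ω) t ω) (N.next (state t ω) (action t ω)) a' ∧
    Q (table t ω) (t + 1) ω (state t ω) (action t ω) =
      (1 - rate t ω) * Q (table t ω) t ω (state t ω) (action t ω) +
        rate t ω * (N.mdp.r (state t ω) (action t ω) +
          γ * Q (table t ω).other t ω (N.next (state t ω) (action t ω)) a')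
  /-- all other entries of both tables stay as they are -/
  update_other : ∀ t ω b s a, ¬ (b = table t ω ∧ s = state t ω ∧ a = action t ω) →
    Q b (t + 1) ω s a = Q b t ω s a

namespace DoubleQLearning

variable {U : ℕ} {N : Network U} {γ ε : ℝ} {Ω : Type*} [MeasurableSpace Ω] {μ : Measure Ω}
  (D : DoubleQLearning N γ ε μ)

/-- The entry `(s, a)` of table `b` is updated at epoch `t`. -/
def Updated (b : Table) (s : N.State) (a : Fin U) (t : ℕ) (ω : Ω) : Prop :=
  D.table t ω = b ∧ D.state t ω = s ∧ D.action t ω = a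

open Classical in
/-- Almost surely, the learning rates used in the updates of any entry of either table have an
infinite sum. For a constant positive learning rate this says that every entry of each of the two
tables is updated infinitely often. -/
def UpdatedForever : Prop :=
  ∀ᵐ ω ∂μ, ∀ b s a, ¬ Summable fun t => if D.Updated b s a t ω then D.rate t ω else 0

/-- Both tables converge almost surely, in every entry, to `Qstar`. -/
def ConvergesTo (Qstar : N.State → Fin U → ℝ) : Prop :=
  ∀ᵐ ω ∂μ, ∀ b s a, Tendsto (fun t => D.Q b t ω s a) atTop (𝓝 (Qstar s a))

/-- In exploration steps the table to be updated is chosen by a fair coin, independently of the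
past and of the action. -/
def FairTables : Prop :=
  ∀ t a b,
    μ[{ω | D.explore t ω ∧ D.action t ω = a ∧ D.table t ω = b}.indicator (fun _ => (1 : ℝ)) | D.ℱ t]
      =ᵐ[μ] fun _ => ε / U / 2

/-- Every run has exactly `L` epochs. -/
def RunLength (L : ℕ) : Prop :=
  ∀ t ω, D.last t ω ↔ L ∣ t + 1

end DoubleQLearning

end

/-! ## Averaging recursions -/

/-! Transitions and rewards are deterministic, so once the step sizes of every entry have divergent
sums, convergence is a statement about a single trajectory, with no noise to average out. Entries
that are not updated get step size `0`. An action that changes the state serves one more user, so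
the transition graph has no cycles except loops, and one can induct backwards on the number of
served users (`tendsto_of_isDoubleQRecursion`). At a state `s` whose successors are settled, the
entries of leaving actions converge because their targets do. For looping actions there are two
cases. If every action loops, the deviations from the fixed point contract by `γ`
(`tendsto_of_forall_loop`). If some action leaves and `γ > 0`, looping is strictly suboptimal
(`lt_iSup_of_bellman`); an upper bound alone shows that maximizers at `s` eventually leave, and on
leaving actions both tables have the same limit, so evaluating one table at the other's maximizer
does no harm (`tendsto_of_lt`). For the second claim, any state is reached from the start by at most
`U < L` actions. Exploration follows them and then makes a prescribed update with a fixed positive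
conditional probability in each run, so conditional Borel–Cantelli gives infinitely many updates
(`frequently_updated`). -/

theorem eventually_le_of_averaging {x y β : ℕ → ℝ} {c η : ℝ}
    (hβ : ∀ t, β t ∈ Set.Icc (0 : ℝ) 1) (hsum : ¬ Summable β)
    (hx : ∀ t, x (t + 1) ≤ (1 - β t) * x t + β t * y t)
    (hy : ∀ᶠ t in atTop, y t ≤ c) (hη : 0 < η) : ∀ᶠ t in atTop, x t ≤ c + η := by
  obtain ⟨T, hT⟩ := eventually_atTop.1 hy
  -- The excess over `c` shrinks by `1 - β ≤ exp (-β)` at each step. The absolute value keeps the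
  -- bound nonnegative, as replacing the factor requires.
  have key : ∀ n, x (n + T) - c ≤
      |x T - c| * Real.exp (-∑ i ∈ Finset.range n, β (i + T)) := by
    intro n
    induction n with
    | zero => simpa using le_abs_self (x T - c)
    | succ n ih =>
      have h1 := hx (n + T)
      have h2 := hT (n + T) (by omega)
      obtain ⟨h3, h4⟩ := hβ (n + T)
      have h5 : 1 - β (n + T) ≤ Real.exp (-β (n + T)) := by
        have := Real.add_one_le_exp (-β (n + T)); linarith
      rw [Finset.sum_range_succ, neg_add, Real.exp_add, ← mul_assoc]
      have h6 : n + 1 + T = n + T + 1 := by ring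
      rw [h6]
      calc x (n + T + 1) - c ≤ (1 - β (n + T)) * (x (n + T) - c) := by
            nlinarith [mul_le_mul_of_nonneg_left h2 h3]
        _ ≤ (1 - β (n + T)) * (|x T - c| * Real.exp (-∑ i ∈ Finset.range n, β (i + T))) :=
            mul_le_mul_of_nonneg_left ih (by linarith)
        _ ≤ Real.exp (-β (n + T)) *
              (|x T - c| * Real.exp (-∑ i ∈ Finset.range n, β (i + T))) :=
            mul_le_mul_of_nonneg_right h5 (by positivity)
        _ = _ := by ring
  have hsum' : ¬ Summable fun i => β (i + T) := fun h => hsum ((summable_nat_add_iff T).1 h)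
  have hlim : Tendsto (fun n => |x T - c| * Real.exp (-∑ i ∈ Finset.range n, β (i + T)))
      atTop (𝓝 (|x T - c| * 0)) := by
    refine Tendsto.const_mul _ (Real.tendsto_exp_atBot.comp (tendsto_neg_atTop_atBot.comp ?_))
    exact (not_summable_iff_tendsto_nat_atTop_of_nonneg fun i => (hβ _).1).1 hsum'
  rw [mul_zero] at hlim
  obtain ⟨K, hK⟩ := eventually_atTop.1 (hlim.eventually (gt_mem_nhds hη))
  refine eventually_atTop.2 ⟨K + T, fun t ht => ?_⟩
  have h1 := key (t - T)
  have h2 := hK (t - T) (by omega)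
  rw [Nat.sub_add_cancel (by omega)] at h1
  linarith

theorem tendsto_of_eventually_bounds {x : ℕ → ℝ} {c : ℝ}
    (h₁ : ∀ η > 0, ∀ᶠ t in atTop, x t ≤ c + η) (h₂ : ∀ η > 0, ∀ᶠ t in atTop, c - η ≤ x t) :
    Tendsto x atTop (𝓝 c) := by
  refine Metric.tendsto_nhds.2 fun e he => ?_
  filter_upwards [h₁ (e / 2) (by linarith), h₂ (e / 2) (by linarith)] with t h3 h4
  rw [Real.dist_eq, abs_lt]
  constructor <;> linarith

theorem tendsto_of_averaging {x y β : ℕ → ℝ} {c : ℝ}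
    (hβ : ∀ t, β t ∈ Set.Icc (0 : ℝ) 1) (hsum : ¬ Summable β)
    (hx : ∀ t, x (t + 1) = (1 - β t) * x t + β t * y t) (hy : Tendsto y atTop (𝓝 c)) :
    Tendsto x atTop (𝓝 c) := by
  refine tendsto_of_eventually_bounds (fun η hη => ?_) fun η hη => ?_
  · have h := eventually_le_of_averaging hβ hsum (fun t => (hx t).le)
      (hy.eventually (ge_mem_nhds (show c < c + η / 2 by linarith))) (half_pos hη)
    filter_upwards [h] with t ht
    linarith
  · have h := eventually_le_of_averaging (x := fun t => -x t) (y := fun t => -y t)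
      (c := -c + η / 2) (η := η / 2) hβ hsum
      (fun t => by rw [hx t]; apply le_of_eq; ring) ?_ (half_pos hη)
    · filter_upwards [h] with t ht
      linarith
    · filter_upwards [hy.eventually (le_mem_nhds (show c - η / 2 < c by linarith))] with t ht
      linarith

/-- If an eventual upper bound `M` of a family can always be improved to (nearly)
`c + γ (M - c)`, then `c` is nearly an eventual upper bound. -/
theorem eventually_le_of_contracting {ι : Type*} [Finite ι] {x : ι → ℕ → ℝ} {c γ M₀ : ℝ}
    (hγ₁ : γ < 1) (h₀ : ∀ i t, x i t ≤ M₀)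
    (h : ∀ M, c ≤ M → (∀ᶠ t in atTop, ∀ i, x i t ≤ M) →
      ∀ i, ∀ η > 0, ∀ᶠ t in atTop, x i t ≤ c + γ * (M - c) + η)
    {η : ℝ} (hη : 0 < η) : ∀ᶠ t in atTop, ∀ i, x i t ≤ c + η := by
  set S : Set ℝ := {M | c ≤ M ∧ ∀ᶠ t in atTop, ∀ i, x i t ≤ M} with hS
  have hne : S.Nonempty := ⟨max c M₀, le_max_left _ _,
    Eventually.of_forall fun t i => (h₀ i t).trans (le_max_right _ _)⟩
  have hbdd : BddBelow S := ⟨c, fun M hM => hM.1⟩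
  have hinf : sInf S ≤ c := by
    by_contra! hlt
    -- For a bound `M`, the improved one is `sInf S - d + γ * (M - sInf S)`. With `M` close to the
    -- infimum and `η = d / 4` it drops below `sInf S`; `|γ| + 1` appears because `γ` may be
    -- negative here.
    have hd : 0 < (1 - γ) * (sInf S - c) := mul_pos (by linarith) (by linarith)
    set d := (1 - γ) * (sInf S - c) with hd_def
    obtain ⟨M, hM, hMlt⟩ := exists_lt_of_csInf_lt hne
      (show sInf S < sInf S + min (d / 4) (d / 4 / (|γ| + 1)) by
        have : 0 < min (d / 4) (d / 4 / (|γ| + 1)) := by positivity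
        linarith)
    have hgM : γ * (M - sInf S) ≤ d / 4 := by
      have h0 : 0 ≤ M - sInf S := by linarith [csInf_le hbdd hM]
      have h1 : M - sInf S ≤ d / 4 / (|γ| + 1) := by
        linarith [min_le_right (d / 4) (d / 4 / (|γ| + 1))]
      rw [le_div_iff₀ (by positivity)] at h1
      nlinarith [le_abs_self γ]
    have hmem : max c (c + γ * (M - c) + d / 4) ∈ S := by
      refine ⟨le_max_left _ _, ?_⟩
      have := eventually_all.2 fun i => h M hM.1 hM.2 i (d / 4) (by linarith)
      filter_upwards [this] with t ht i
      exact (ht i).trans (le_max_right _ _)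
    have h1 := csInf_le hbdd hmem
    rcases le_max_iff.1 h1 with h2 | h2
    · linarith
    · nlinarith
  obtain ⟨M, hM, hMlt⟩ := exists_lt_of_csInf_lt hne (show sInf S < c + η by linarith)
  filter_upwards [hM.2] with t ht i
  exact (ht i).trans hMlt.le

/-- Evaluating one table at the maximizers of another one that has the same limit. -/
theorem tendsto_eval_of_argmax {A : Type*} [Finite A] {f g : ℕ → A → ℝ} {h : A → ℝ} {P : Set A}
    {a : ℕ → A} {a₀ : A} (ha : ∀ t a', f t a' ≤ f t (a t)) (haP : ∀ᶠ t in atTop, a t ∈ P)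
    (hf : ∀ a' ∈ P, Tendsto (fun t => f t a') atTop (𝓝 (h a')))
    (hg : ∀ a' ∈ P, Tendsto (fun t => g t a') atTop (𝓝 (h a')))
    (ha₀ : a₀ ∈ P) (hmax : ∀ a' ∈ P, h a' ≤ h a₀) :
    Tendsto (fun t => g t (a t)) atTop (𝓝 (h a₀)) := by
  refine Metric.tendsto_nhds.2 fun e he => ?_
  have hf' : ∀ᶠ t in atTop, ∀ a', a' ∈ P → |f t a' - h a'| < e / 4 :=
    eventually_all.2 fun a' => by
      by_cases hp : a' ∈ P
      · filter_upwards [Metric.tendsto_nhds.1 (hf a' hp) (e / 4) (by linarith)] with t ht _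
        exact ht
      · exact Eventually.of_forall fun t h => absurd h hp
  have hg' : ∀ᶠ t in atTop, ∀ a', a' ∈ P → |g t a' - h a'| < e / 4 :=
    eventually_all.2 fun a' => by
      by_cases hp : a' ∈ P
      · filter_upwards [Metric.tendsto_nhds.1 (hg a' hp) (e / 4) (by linarith)] with t ht _
        exact ht
      · exact Eventually.of_forall fun t h => absurd h hp
  filter_upwards [hf', hg', haP] with t h1 h2 h3
  -- For the lower bound, pass from `g` to `h` to `f` at `a t`, then to `f` and `h` at `a₀`: three
  -- errors of `e / 4`.
  have h4 := abs_lt.1 (h1 _ h3)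
  have h5 := abs_lt.1 (h2 _ h3)
  have h6 := abs_lt.1 (h1 _ ha₀)
  have h7 := ha t a₀
  have h8 := hmax _ h3
  rw [Real.dist_eq, abs_lt]
  constructor <;> linarith

/-! ## Convergence of double Q-learning along a single trajectory -/

instance : Finite Table :=
  Finite.of_surjective (fun b : Bool => if b then Table.A else Table.B) fun b => by
    cases b
    · exact ⟨true, rfl⟩
    · exact ⟨false, rfl⟩

/-- The tables `Q` follow the double Q-learning recursion with deterministic transitions `next`,
rewards `rew`, step sizes `β` and maximizers `arg`. -/
structure IsDoubleQRecursion {S A : Type*} (next : S → A → S) (rew : S → ℝ) (γ : ℝ)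
    (Q : Table → ℕ → S → A → ℝ) (β : Table → S → A → ℕ → ℝ)
    (arg : Table → ℕ → S → A → A) : Prop where
  rate_mem : ∀ b s a t, β b s a t ∈ Set.Icc (0 : ℝ) 1
  not_summable : ∀ b s a, ¬ Summable (β b s a)
  isArgmax : ∀ b t s a, IsArgmax (Q b t) (next s a) (arg b t s a)
  update : ∀ b s a t, Q b (t + 1) s a = (1 - β b s a t) * Q b t s a +
    β b s a t * (rew s + γ * Q b.other t (next s a) (arg b t s a))

namespace IsDoubleQRecursion

variable {S A : Type*} {next : S → A → S} {rew : S → ℝ}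
  {γ : ℝ} {Q : Table → ℕ → S → A → ℝ} {β : Table → S → A → ℕ → ℝ} {arg : Table → ℕ → S → A → A}

theorem tendsto_of_tendsto_target (h : IsDoubleQRecursion next rew γ Q β arg) {b : Table} {s : S}
    {a : A} {v : ℝ}
    (hv : Tendsto (fun t => Q b.other t (next s a) (arg b t s a)) atTop (𝓝 v)) :
    Tendsto (fun t => Q b t s a) atTop (𝓝 (rew s + γ * v)) :=
  tendsto_of_averaging (h.rate_mem b s a) (h.not_summable b s a) (h.update b s a)
    (tendsto_const_nhds.add (hv.const_mul γ))

variable [Finite S] [Finite A]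

/-- If `R` bounds the rewards and `B ≥ R / (1 - γ)`, then `R + γ * B ≤ B`, so `[-B, B]` is invariant
under the updates. -/
theorem exists_bound (h : IsDoubleQRecursion next rew γ Q β arg) (hγ₀ : 0 ≤ γ) (hγ₁ : γ < 1) :
    ∃ B, ∀ t b s a, |Q b t s a| ≤ B := by
  obtain ⟨B₀, hB₀⟩ := Finite.exists_le fun p : Table × S × A => |Q p.1 0 p.2.1 p.2.2|
  obtain ⟨R, hR⟩ := Finite.exists_le fun s => |rew s|
  refine ⟨max B₀ (R / (1 - γ)), fun t => ?_⟩
  have hRB : R ≤ (1 - γ) * max B₀ (R / (1 - γ)) := by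
    have := le_max_right B₀ (R / (1 - γ))
    rwa [div_le_iff₀' (by linarith)] at this
  set B := max B₀ (R / (1 - γ))
  induction t with
  | zero => exact fun b s a => (hB₀ (b, s, a)).trans (le_max_left _ _)
  | succ t ih =>
    intro b s a
    obtain ⟨h1, h2⟩ := h.rate_mem b s a t
    have h3 := abs_le.1 (ih b s a)
    have h4 := abs_le.1 (ih b.other (next s a) (arg b t s a))
    have h5 := abs_le.1 (hR s)
    rw [h.update b s a t]
    have h6 : rew s + γ * Q b.other t (next s a) (arg b t s a) ≤ B := by nlinarith
    have h7 : -B ≤ rew s + γ * Q b.other t (next s a) (arg b t s a) := by nlinarith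
    rw [abs_le]
    constructor <;> nlinarith

/-- A state all of whose actions lead back to it. -/
theorem tendsto_of_forall_loop (h : IsDoubleQRecursion next rew γ Q β arg) (hγ₀ : 0 ≤ γ)
    (hγ₁ : γ < 1) {s : S} (hs : ∀ a, next s a = s) {v : ℝ} (hv : v = rew s + γ * v)
    (b : Table) (a : A) : Tendsto (fun t => Q b t s a) atTop (𝓝 v) := by
  obtain ⟨B, hB⟩ := h.exists_bound hγ₀ hγ₁
  -- Both tables are treated together: whatever the maximizer, the target's deviation from `v` is
  -- `γ` times that of an entry of the other table at `s`.
  have key : ∀ η > 0, ∀ᶠ t in atTop, ∀ p : Table × A, |Q p.1 t s p.2 - v| ≤ 0 + η := by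
    intro η hη
    refine eventually_le_of_contracting (ι := Table × A) (x := fun p t => |Q p.1 t s p.2 - v|)
      (M₀ := B + |v|) hγ₁
      (fun p t => (abs_sub _ _).trans (add_le_add_left (hB _ _ _ _) _)) ?_ hη
    rintro M - hM ⟨b, a⟩ δ hδ
    refine eventually_le_of_averaging (y := fun t =>
      |rew s + γ * Q b.other t (next s a) (arg b t s a) - v|)
      (h.rate_mem b s a) (h.not_summable b s a) (fun t => ?_) ?_ hδ
    · obtain ⟨h1, h2⟩ := h.rate_mem b s a t
      simp only [h.update b s a t]
      calc _ = |(1 - β b s a t) * (Q b t s a - v) + β b s a t *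
            (rew s + γ * Q b.other t (next s a) (arg b t s a) - v)| := by congr 1; ring
        _ ≤ _ := by
            refine (abs_add_le _ _).trans_eq ?_
            rw [abs_mul, abs_mul, abs_of_nonneg h1, abs_of_nonneg (sub_nonneg.2 h2)]
    · filter_upwards [hM] with t ht
      have h1 := ht (b.other, arg b t s a)
      have h2 : rew s + γ * Q b.other t (next s a) (arg b t s a) - v
          = γ * (Q b.other t s (arg b t s a) - v) := by
        rw [hs a]; linear_combination -hv
      rw [h2, abs_mul, abs_of_nonneg hγ₀]
      have := mul_le_mul_of_nonneg_left h1 hγ₀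
      simpa using this
  refine tendsto_of_eventually_bounds (fun η hη => ?_) fun η hη => ?_ <;>
  · filter_upwards [key η hη] with t ht
    have := abs_le.1 (ht (b, a))
    linarith [this.1, this.2]

/-- A state from which the optimal actions lead to other states. -/
theorem tendsto_of_lt (h : IsDoubleQRecursion next rew γ Q β arg) (hγ₀ : 0 ≤ γ)
    (hγ₁ : γ < 1) {s : S} {q : A → ℝ} {a₀ : A} (ha₀ : next s a₀ ≠ s) (hmax : ∀ a, q a ≤ q a₀)
    (hlt : rew s + γ * q a₀ < q a₀)
    (hq : ∀ a, next s a ≠ s → ∀ b, Tendsto (fun t => Q b t s a) atTop (𝓝 (q a)))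
    {a : A} (ha : next s a = s) (b : Table) :
    Tendsto (fun t => Q b t s a) atTop (𝓝 (rew s + γ * q a₀)) := by
  obtain ⟨B, hB⟩ := h.exists_bound hγ₀ hγ₁
  set v := q a₀ with hv
  -- Only upper bounds propagate this simply: the other table may be small at this table's
  -- maximizer.
  have loop : ∀ M, (∀ᶠ t in atTop, ∀ p : Table × A, Q p.1 t s p.2 ≤ M) → ∀ b a, next s a = s →
      ∀ η > 0, ∀ᶠ t in atTop, Q b t s a ≤ rew s + γ * M + η := by
    intro M hM b a ha η hη
    refine eventually_le_of_averaging (h.rate_mem b s a) (h.not_summable b s a)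
      (fun t => (h.update b s a t).le) ?_ hη
    filter_upwards [hM] with t ht
    have := mul_le_mul_of_nonneg_left (ht (b.other, arg b t s a)) hγ₀
    rw [ha]
    linarith
  have upper : ∀ η > 0, ∀ᶠ t in atTop, ∀ p : Table × A, Q p.1 t s p.2 ≤ v + η := by
    intro η hη
    refine eventually_le_of_contracting (ι := Table × A) (x := fun p t => Q p.1 t s p.2)
      (M₀ := B) hγ₁ (fun p t => (le_abs_self _).trans (hB _ _ _ _)) ?_ hη
    rintro M hcM hM ⟨b, a⟩ δ hδ
    by_cases ha : next s a = s
    · filter_upwards [loop M hM b a ha δ hδ] with t ht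
      linarith
    · filter_upwards [(hq a ha b).eventually (ge_mem_nhds (show q a < q a + δ by linarith))]
        with t ht
      have := hmax a
      have := mul_nonneg hγ₀ (sub_nonneg.2 hcM)
      linarith
  refine h.tendsto_of_tendsto_target ?_
  rw [ha]
  have harg : ∀ t a', Q b t s a' ≤ Q b t s (arg b t s a) := fun t a' => by
    have := h.isArgmax b t s a a'
    rwa [ha] at this
  refine tendsto_eval_of_argmax (f := fun t => Q b t s) (g := fun t => Q b.other t s) (h := q)
    (P := {a' | next s a' ≠ s}) harg ?_ (fun a' ha' => hq a' ha' b)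
    (fun a' ha' => hq a' ha' b.other) ha₀ fun a' _ => hmax a'
  set d := v - (rew s + γ * v) with hd
  have hd0 : 0 < d := by linarith
  -- The bound is `rew s + γ * (v + d / 4) + d / 4 ≤ v - d / 2`. Since the entry of `a₀` tends to
  -- `v`, no looping action is eventually a maximizer.
  have hloop : ∀ᶠ t in atTop, ∀ a', next s a' = s → Q b t s a' ≤ v - d / 2 := by
    refine eventually_all.2 fun a' => ?_
    by_cases ha' : next s a' = s
    · filter_upwards [loop _ (upper (d / 4) (by linarith)) b a' ha' (d / 4) (by linarith)]
        with t ht _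
      nlinarith
    · exact Eventually.of_forall fun t h => absurd h ha'
  filter_upwards [hloop, (hq a₀ ha₀ b).eventually
    (lt_mem_nhds (show q a₀ - d / 2 < q a₀ by linarith))] with t h1 h2 h3
  have := h1 _ h3
  have := harg t a₀
  linarith

/-- The induction step at one state. The gap is only asked for `γ > 0`: at `γ = 0` all actions tie,
but then the target is just the reward. -/
theorem tendsto_of_successors [Nonempty A] (h : IsDoubleQRecursion next rew γ Q β arg)
    (hγ₀ : 0 ≤ γ) (hγ₁ : γ < 1) {Qs : S → A → ℝ}
    (hQs : ∀ s a, Qs s a = rew s + γ * ⨆ a', Qs (next s a) a') {s : S}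
    (hgap : (∃ a, next s a ≠ s) → 0 < γ →
      ∀ a, next s a = s → Qs s a < ⨆ a', Qs s a')
    (hsucc : ∀ a, next s a ≠ s → ∀ b a',
      Tendsto (fun t => Q b t (next s a) a') atTop (𝓝 (Qs (next s a) a')))
    (b : Table) (a : A) : Tendsto (fun t => Q b t s a) atTop (𝓝 (Qs s a)) := by
  have hsup : ∀ s, ∃ a₀, (∀ a, Qs s a ≤ Qs s a₀) ∧ ⨆ a', Qs s a' = Qs s a₀ := fun s => by
    obtain ⟨a₀, h₀⟩ := Finite.exists_max (Qs s)
    exact ⟨a₀, h₀, le_antisymm (ciSup_le h₀) (le_ciSup (Set.finite_range _).bddAbove a₀)⟩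
  have hmove : ∀ a, next s a ≠ s → ∀ b, Tendsto (fun t => Q b t s a) atTop (𝓝 (Qs s a)) := by
    intro a ha b
    obtain ⟨a₀, h₀, h₁⟩ := hsup (next s a)
    rw [hQs s a, h₁]
    exact h.tendsto_of_tendsto_target (tendsto_eval_of_argmax (f := fun t => Q b t (next s a))
      (g := fun t => Q b.other t (next s a)) (h := Qs (next s a)) (P := Set.univ)
      (fun t a' => h.isArgmax b t s a a') (by simp) (fun a' _ => hsucc a ha b a')
      (fun a' _ => hsucc a ha b.other a') (Set.mem_univ _) fun a' _ => h₀ a')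
  by_cases ha : next s a = s
  swap
  · exact hmove a ha b
  obtain ⟨a₀, h₀, h₁⟩ := hsup s
  rcases hγ₀.eq_or_lt with rfl | hγ
  · have h2 : Qs s a = rew s := by simpa using hQs s a
    rw [h2]
    refine tendsto_of_averaging (y := fun _ => rew s) (h.rate_mem b s a) (h.not_summable b s a)
      (fun t => ?_) tendsto_const_nhds
    simpa using h.update b s a t
  · by_cases hne : ∃ a, next s a ≠ s
    · have hlt := hgap hne hγ
      have ha₀ : next s a₀ ≠ s := fun h2 => by
        have := hlt a₀ h2
        rw [h₁] at this
        exact lt_irrefl _ this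
      have h3 := hQs s a
      rw [ha, h₁] at h3
      rw [h3]
      refine h.tendsto_of_lt hγ₀ hγ₁ ha₀ h₀ ?_ hmove ha b
      rw [← h3, ← h₁]
      exact hlt a ha
    · push Not at hne
      have h3 : ∀ a', Qs s a' = Qs s a := fun a' => by rw [hQs s a', hQs s a, hne, hne]
      refine h.tendsto_of_forall_loop hγ₀ hγ₁ hne ?_ b a
      conv_lhs => rw [hQs s a, hne a, h₁, h3 a₀]

end IsDoubleQRecursion

/-! ## Bellman's equation for the UAV -/

theorem abs_ciSup_sub_ciSup_le {A : Type*} [Finite A] [Nonempty A] {f g : A → ℝ} {d : ℝ}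
    (h : ∀ a, |f a - g a| ≤ d) : |(⨆ a, f a) - ⨆ a, g a| ≤ d := by
  have key : ∀ {f g : A → ℝ}, (∀ a, |f a - g a| ≤ d) → (⨆ a, f a) ≤ (⨆ a, g a) + d :=
    fun {f g} h => ciSup_le fun a => by
      have := le_ciSup (Set.finite_range g).bddAbove a
      have := (abs_le.1 (h a)).2
      linarith
  have h1 := key h
  have h2 := key (f := g) (g := f) fun a => by rw [abs_sub_comm]; exact h a
  rw [abs_le]
  constructor <;> linarith

/-- Taking a maximum is 1-Lipschitz for the sup distance, so Banach's fixed point theorem applies.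
-/
theorem existsUnique_bellman {S A : Type*} [Fintype S] [Fintype A] (next : S → A → S)
    (rew : S → ℝ) {γ : ℝ} (hγ₀ : 0 ≤ γ) (hγ₁ : γ < 1) :
    ∃! Q : S → A → ℝ, ∀ s a, Q s a = rew s + γ * ⨆ a', Q (next s a) a' := by
  let F : (S → A → ℝ) → S → A → ℝ := fun Q s a => rew s + γ * ⨆ a', Q (next s a) a'
  have hF : ContractingWith ⟨γ, hγ₀⟩ F := by
    refine ⟨by exact_mod_cast hγ₁, LipschitzWith.of_dist_le_mul fun Q Q' => ?_⟩
    refine (dist_pi_le_iff (by positivity)).2 fun s => (dist_pi_le_iff (by positivity)).2 fun a => ?_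
    have : Nonempty A := ⟨a⟩
    have h1 := abs_ciSup_sub_ciSup_le (f := Q (next s a)) (g := Q' (next s a)) (d := dist Q Q')
      fun a' => by
        rw [← Real.dist_eq]
        exact (dist_le_pi_dist (Q (next s a)) _ a').trans (dist_le_pi_dist Q Q' _)
    calc dist (F Q s a) (F Q' s a)
        = |γ * ((⨆ a', Q (next s a) a') - ⨆ a', Q' (next s a) a')| := by
          rw [Real.dist_eq]; congr 1; simp only [F]; ring
      _ = γ * |(⨆ a', Q (next s a) a') - ⨆ a', Q' (next s a) a'| := by
          rw [abs_mul, abs_of_nonneg hγ₀]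
      _ ≤ γ * dist Q Q' := mul_le_mul_of_nonneg_left h1 hγ₀
  refine ⟨ContractingWith.fixedPoint F hF, fun s a => ?_, fun Q hQ => ?_⟩
  · exact (congrFun (congrFun hF.fixedPoint_isFixedPt s) a).symm
  · exact hF.fixedPoint_unique (funext fun s => funext fun a => (hQ s a).symm)

namespace Network

variable {U : ℕ} (N : Network U)

/-- The number of satisfied users. -/
def reward (s : N.State) : ℝ := ∑ i, if s.1.w i then 1 else 0

theorem reward_le (s : N.State) : N.reward s ≤ U := by
  calc N.reward s ≤ ∑ _i : Fin U, (1 : ℝ) :=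
        Finset.sum_le_sum fun i _ => by split_ifs <;> norm_num
    _ = U := by simp

/-- This excludes all cycles except loops. -/
theorem reward_next {s : N.State} {a : Fin U} (h : N.next s a ≠ s) :
    N.reward (N.next s a) = N.reward s + 1 := by
  have hc : N.CanServe s.1 a := by
    by_contra hc
    exact h (Subtype.ext (if_neg hc))
  have hs : (N.next s a).1 = N.serve s.1 a := if_pos hc
  have hw := hc.1
  unfold reward
  rw [hs, ← Finset.add_sum_erase _ _ (Finset.mem_univ a),
    ← Finset.add_sum_erase (a := a) _ (fun i => if s.1.w i then (1 : ℝ) else 0)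
      (Finset.mem_univ a)]
  have : ∀ i ∈ Finset.univ.erase a, (if (N.serve s.1 a).w i then (1 : ℝ) else 0)
      = if s.1.w i then 1 else 0 := fun i hi => by
    simp [serve, Function.update_of_ne (Finset.ne_of_mem_erase hi)]
  rw [Finset.sum_congr rfl this]
  simp [serve, hw, add_comm]

theorem isBellmanOptimal_iff {γ : ℝ} {Q : N.State → Fin U → ℝ} :
    N.mdp.IsBellmanOptimal γ Q ↔
      ∀ s a, Q s a = N.reward s + γ * ⨆ a', Q (N.next s a) a' := by
  simp [FiniteMDP.IsBellmanOptimal, mdp, reward]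

variable {N} {γ : ℝ} {Q : N.State → Fin U → ℝ}

/-- The left side is the value of staying at `s` forever. Rewards never decrease along transitions,
so the minimum `m` of the difference over all entries satisfies `m ≥ γ * m`, whence `m ≥ 0`. -/
theorem reward_div_le_of_bellman (hγ₀ : 0 ≤ γ) (hγ₁ : γ < 1)
    (hQ : ∀ s a, Q s a = N.reward s + γ * ⨆ a', Q (N.next s a) a') (s : N.State) (a : Fin U) :
    N.reward s / (1 - γ) ≤ Q s a := by
  have : Nonempty (N.State × Fin U) := ⟨(s, a)⟩
  obtain ⟨⟨s₀, a₀⟩, h₀⟩ := Finite.exists_min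
    fun p : N.State × Fin U => Q p.1 p.2 - N.reward p.1 / (1 - γ)
  have hpos : 0 < 1 - γ := by linarith
  have h1 : N.reward s₀ ≤ N.reward (N.next s₀ a₀) := by
    by_cases h : N.next s₀ a₀ = s₀
    · rw [h]
    · rw [N.reward_next h]; linarith
  have h2 : N.reward s₀ / (1 - γ) ≤ N.reward (N.next s₀ a₀) / (1 - γ) := by gcongr
  have h3 := h₀ (N.next s₀ a₀, a₀)
  have h4 : Q (N.next s₀ a₀) a₀ ≤ ⨆ a', Q (N.next s₀ a₀) a' :=
    le_ciSup (Set.finite_range (Q (N.next s₀ a₀))).bddAbove a₀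
  have h5 := hQ s₀ a₀
  have h6 : N.reward s₀ = (1 - γ) * (N.reward s₀ / (1 - γ)) := by field_simp
  have h7 := h₀ (s, a)
  simp only at h3 h7
  have h8 := mul_le_mul_of_nonneg_left
    (show N.reward s₀ / (1 - γ) + (Q s₀ a₀ - N.reward s₀ / (1 - γ)) ≤
      ⨆ a', Q (N.next s₀ a₀) a' by linarith) hγ₀
  nlinarith

/-- Where some user can be served, not serving anyone is not optimal. -/
theorem lt_iSup_of_bellman (hγ₀ : 0 < γ) (hγ₁ : γ < 1)
    (hQ : ∀ s a, Q s a = N.reward s + γ * ⨆ a', Q (N.next s a) a') {s : N.State}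
    (hs : ∃ a, N.next s a ≠ s) {a : Fin U} (ha : N.next s a = s) :
    Q s a < ⨆ a', Q s a' := by
  obtain ⟨a₁, ha₁⟩ := hs
  have hpos : 0 < 1 - γ := by linarith
  have h1 : Q s a₁ ≤ ⨆ a', Q s a' := le_ciSup (Set.finite_range (Q s)).bddAbove a₁
  have h2 : Q (N.next s a₁) a₁ ≤ ⨆ a', Q (N.next s a₁) a' :=
    le_ciSup (Set.finite_range (Q (N.next s a₁))).bddAbove a₁
  -- Leaving by `a₁` is worth at least `(N.reward s + γ) / (1 - γ)`, hence the supremum `V`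
  -- satisfies `N.reward s + γ * V < V`.
  have h3 := reward_div_le_of_bellman hγ₀.le hγ₁ hQ (N.next s a₁) a₁
  rw [N.reward_next ha₁, div_le_iff₀ hpos] at h3
  have h4 := hQ s a
  rw [ha] at h4
  have h5 := hQ s a₁
  have h6 := mul_le_mul_of_nonneg_left h2 hγ₀.le
  nlinarith

theorem tendsto_of_isDoubleQRecursion [Nonempty (Fin U)] (hγ₀ : 0 ≤ γ) (hγ₁ : γ < 1)
    (hQ : ∀ s a, Q s a = N.reward s + γ * ⨆ a', Q (N.next s a) a')
    {q : Table → ℕ → N.State → Fin U → ℝ} {β : Table → N.State → Fin U → ℕ → ℝ}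
    {arg : Table → ℕ → N.State → Fin U → Fin U}
    (h : IsDoubleQRecursion N.next N.reward γ q β arg) (b : Table) (s : N.State) (a : Fin U) :
    Tendsto (fun t => q b t s a) atTop (𝓝 (Q s a)) := by
  -- Here `n` exceeds the number of users still unserved; `n = 0` is vacuous.
  suffices key : ∀ (n : ℕ) (s : N.State), (U : ℝ) < N.reward s + n → ∀ b a,
      Tendsto (fun t => q b t s a) atTop (𝓝 (Q s a)) by
    obtain ⟨n, hn⟩ := exists_nat_gt ((U : ℝ) - N.reward s)
    exact key n s (by linarith) b a
  intro n
  induction n with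
  | zero =>
    intro s hs
    have := N.reward_le s
    push_cast at hs
    linarith
  | succ n ih =>
    intro s hs b a
    refine h.tendsto_of_successors hγ₀ hγ₁ hQ
      (fun hne hγ a ha => lt_iSup_of_bellman hγ hγ₁ hQ hne ha)
      (fun a ha b a' => ih _ ?_ b a') b a
    rw [N.reward_next ha]
    push_cast at hs
    linarith

end Network

namespace DoubleQLearning

variable {U : ℕ} {N : Network U} {γ ε : ℝ} {Ω : Type*} [MeasurableSpace Ω] {μ : Measure Ω}
  (D : DoubleQLearning N γ ε μ)

open Classical in
/-- The step size of an entry: `0` where the entry is not updated. -/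
noncomputable def stepSize (ω : Ω) (b : Table) (s : N.State) (a : Fin U) (t : ℕ) : ℝ :=
  if D.Updated b s a t ω then D.rate t ω else 0

theorem exists_isDoubleQRecursion {ω : Ω}
    (hω : ∀ b s a, ¬ Summable (D.stepSize ω b s a)) :
    ∃ arg, IsDoubleQRecursion N.next N.reward γ (fun b t => D.Q b t ω) (D.stepSize ω) arg := by
  have : Nonempty (Fin U) := ⟨D.action 0 ω⟩
  have H : ∀ b t s a, ∃ a', IsArgmax (D.Q b t ω) (N.next s a) a' ∧
      D.Q b (t + 1) ω s a = (1 - D.stepSize ω b s a t) * D.Q b t ω s a + D.stepSize ω b s a t *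
        (N.reward s + γ * D.Q b.other t ω (N.next s a) a') := by
    intro b t s a
    by_cases hu : D.Updated b s a t ω
    · obtain ⟨a', h1, h2⟩ := D.update t ω
      obtain ⟨rfl, rfl, rfl⟩ := hu
      refine ⟨a', h1, h2.trans ?_⟩
      simp only [stepSize, Updated, and_self, if_true]
      rfl
    · obtain ⟨a', h1⟩ := Finite.exists_max (D.Q b t ω (N.next s a))
      refine ⟨a', h1, ?_⟩
      rw [D.update_other t ω b s a fun h => hu ⟨h.1.symm, h.2.1.symm, h.2.2.symm⟩]
      simp [stepSize, hu]
  choose arg h1 h2 using H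
  refine ⟨arg, fun b s a t => ?_, hω, h1, fun b s a t => h2 b t s a⟩
  unfold stepSize
  split_ifs
  · exact D.rate_mem t ω
  · exact ⟨le_rfl, zero_le_one⟩

theorem convergesTo_of_updatedForever (hγ₀ : 0 ≤ γ) (hγ₁ : γ < 1) {Qs : N.State → Fin U → ℝ}
    (hQs : N.mdp.IsBellmanOptimal γ Qs) (h : D.UpdatedForever) : D.ConvergesTo Qs := by
  filter_upwards [h] with ω hω b s a
  have : Nonempty (Fin U) := ⟨a⟩
  obtain ⟨arg, harg⟩ := D.exists_isDoubleQRecursion hω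
  exact Network.tendsto_of_isDoubleQRecursion hγ₀ hγ₁ (N.isBellmanOptimal_iff.1 hQs) harg b s a

end DoubleQLearning

/-! ## Every entry is updated infinitely often -/

/-- Tower property: given `ℱ (T + n)` the earlier events are known and the last one contributes the
constant `p n`. -/
theorem condExp_indicator_forall_lt {Ω : Type*} {m : MeasurableSpace Ω} {μ : Measure Ω}
    [IsProbabilityMeasure μ] (ℱ : Filtration ℕ m) {T n : ℕ} {C : ℕ → Set Ω} {p : ℕ → ℝ}
    (hC : ∀ j < n, MeasurableSet[ℱ (T + j + 1)] (C j))
    (hp : ∀ j < n, μ[(C j).indicator (fun _ => (1 : ℝ)) | ℱ (T + j)] =ᵐ[μ] fun _ => p j) :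
    MeasurableSet[ℱ (T + n)] {ω | ∀ j < n, ω ∈ C j} ∧
    μ[{ω | ∀ j < n, ω ∈ C j}.indicator (fun _ => (1 : ℝ)) | ℱ T]
      =ᵐ[μ] fun _ => ∏ j ∈ Finset.range n, p j := by
  induction n with
  | zero =>
    simp only [Nat.not_lt_zero, false_implies, implies_true, Set.ofPred_true, Set.indicator_univ,
      Finset.range_zero, Finset.prod_empty]
    exact ⟨MeasurableSet.univ, by rw [condExp_const (ℱ.le T)]⟩
  | succ n ih =>
    obtain ⟨h1, h2⟩ := ih (fun j hj => hC j (by omega)) fun j hj => hp j (by omega)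
    set A := {ω | ∀ j < n, ω ∈ C j} with hA
    have hsplit : {ω | ∀ j < n + 1, ω ∈ C j} = A ∩ C n := by
      ext ω
      simp only [Nat.lt_succ_iff_lt_or_eq, Set.mem_ofPred_eq, Set.mem_inter_iff, hA]
      exact ⟨fun h => ⟨fun j hj => h j (.inl hj), h n (.inr rfl)⟩,
        fun h j hj => hj.elim (h.1 j) fun hj => hj ▸ h.2⟩
    have hCn := hC n (by omega)
    rw [hsplit]
    refine ⟨(ℱ.mono (by omega) _ h1).inter hCn, ?_⟩
    rw [← Set.indicator_indicator]
    have hint : Integrable ((C n).indicator fun _ => (1 : ℝ)) μ :=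
      (integrable_const 1).indicator (ℱ.le _ _ hCn)
    have h3 : μ[A.indicator ((C n).indicator fun _ => (1 : ℝ)) | ℱ (T + n)]
        =ᵐ[μ] p n • A.indicator fun _ => (1 : ℝ) := by
      filter_upwards [condExp_indicator hint h1, hp n (by omega)] with ω h4 h5
      rw [h4]
      by_cases hω : ω ∈ A <;> simp [hω, h5]
    refine (condExp_condExp_of_le (ℱ.mono (Nat.le_add_right T n)) (ℱ.le _)).symm.trans ?_
    refine (condExp_congr_ae h3).trans ?_
    filter_upwards [condExp_smul (p n) (A.indicator fun _ => (1 : ℝ)) (ℱ T) (μ := μ), h2]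
      with ω h4 h5
    rw [h4, Finset.prod_range_succ, Pi.smul_apply, h5, smul_eq_mul, mul_comm]

namespace DoubleQLearning

variable {U : ℕ} {N : Network U} {γ ε : ℝ} {Ω : Type*} [MeasurableSpace Ω] {μ : Measure Ω}
  (D : DoubleQLearning N γ ε μ)

theorem state_mul_of_runLength {L : ℕ} (hL : 0 < L) (h : D.RunLength L) (k : ℕ) (ω : Ω) :
    D.state (k * L) ω = N.start := by
  rcases k with _ | k
  · simpa using D.state_zero ω
  · have h1 : (k + 1) * L = (k + 1) * L - 1 + 1 :=
      (Nat.sub_add_cancel (Nat.mul_pos k.succ_pos hL)).symm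
    rw [h1]
    exact D.state_last _ _ ((h _ _).2 (h1 ▸ Dvd.intro_left _ rfl))

/-- Within a run, the actions decide the states. -/
theorem state_eq_foldl {L : ℕ} (h : D.RunLength L) (k : ℕ) (ω : Ω) {l : List (Fin U)}
    (hl : l.length < L) (hact : ∀ j (hj : j < l.length), D.action (k * L + j) ω = l[j]) :
    ∀ j ≤ l.length, D.state (k * L + j) ω = (l.take j).foldl N.next N.start := by
  intro j
  induction j with
  | zero => exact fun _ => by simpa using D.state_mul_of_runLength (by omega) h k ω
  | succ j ih =>
    intro hj
    have hlast : ¬ D.last (k * L + j) ω := by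
      rw [h, add_assoc, Nat.dvd_add_right (Dvd.intro_left _ rfl)]
      exact fun hd => absurd (Nat.le_of_dvd j.succ_pos hd) (by omega)
    rw [← add_assoc, D.state_succ _ _ hlast, ih (by omega), hact j (by omega),
      List.take_succ_eq_append_getElem (by omega), List.foldl_append]
    rfl

/-- Each action of the list serves a new user. As `U < L`, the list fits in a run and leaves an
epoch for the update at `s`. -/
theorem exists_actions (s : N.State) :
    ∃ l : List (Fin U), l.length ≤ U ∧ l.foldl N.next N.start = s := by
  obtain ⟨l, hl, h⟩ := Network.Reachable.exists_list N s.2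
  refine ⟨l, hl.trans_le ((Finset.card_le_univ _).trans_eq (Fintype.card_fin U)),
    Subtype.ext (Eq.trans ?_ h)⟩
  have : ∀ (l : List (Fin U)) (s : N.State), (l.foldl N.next s).1 = l.foldl N.step s.1 := by
    intro l
    induction l with
    | nil => exact fun _ => rfl
    | cons a l ih => exact fun s => ih _
  exact this l _

theorem frequently_updated [IsProbabilityMeasure μ] (hε : 0 < ε) {L : ℕ} (hL : U < L)
    (hfair : D.FairTables) (hrun : D.RunLength L) (b : Table) (s : N.State) (a : Fin U) :
    ∀ᵐ ω ∂μ, ∃ᶠ t in atTop, D.Updated b s a t ω := by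
  obtain ⟨l, hlU, hls⟩ := exists_actions s
  have hU : (0 : ℝ) < U := by exact_mod_cast a.pos
  let n := l.length
  -- In a run starting at `T`, exploration follows `l` to `s`, then epoch `T + n` makes the desired
  -- update.
  let C : ℕ → ℕ → Set Ω := fun T j =>
    if hj : j < l.length then {ω | D.explore (T + j) ω ∧ D.action (T + j) ω = l[j]}
    else {ω | D.explore (T + j) ω ∧ D.action (T + j) ω = a ∧ D.table (T + j) ω = b}
  let p : ℕ → ℝ := fun j => if j < l.length then ε / U else ε / U / 2
  have hCmeas : ∀ T, ∀ j < n + 1, MeasurableSet[D.ℱ (T + j + 1)] (C T j) := by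
    intro T j _
    simp only [C]
    split_ifs
    · exact (D.measurable_explore _).inter (D.measurable_action _ _)
    · exact (D.measurable_explore _).inter
        ((D.measurable_action _ _).inter (D.measurable_table _ _))
  have hCp : ∀ T, ∀ j < n + 1,
      μ[(C T j).indicator (fun _ => (1 : ℝ)) | D.ℱ (T + j)] =ᵐ[μ] fun _ => p j := by
    intro T j _
    simp only [C, p]
    split_ifs
    · exact D.explore_uniform _ _
    · exact hfair _ _ _
  have hE := fun T => condExp_indicator_forall_lt D.ℱ (hCmeas T) (hCp T)
  let 𝒢 : Filtration ℕ (inferInstance : MeasurableSpace Ω) :=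
    { seq := fun k => D.ℱ (k * L)
      mono' := fun i j hij => D.ℱ.mono (Nat.mul_le_mul_right L hij)
      le' := fun k => D.ℱ.le _ }
  -- The event of run `k` has index `k + 1`: it is known when the next run starts, since `n + 1 ≤
  -- L`, and is conditioned on the start of its own run. Index `0` is a dummy.
  let E : ℕ → Set Ω := fun k =>
    match k with
    | 0 => ∅
    | k + 1 => {ω | ∀ j < n + 1, ω ∈ C (k * L) j}
  have hEmeas : ∀ k, MeasurableSet[𝒢 k] (E k) := by
    rintro (_ | k)
    · exact @MeasurableSet.empty _ (𝒢 0)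
    · refine D.ℱ.mono ?_ _ (hE (k * L)).1
      rw [add_mul, one_mul]
      exact Nat.add_le_add_left (by omega) _
  have hpos : 0 < ∏ j ∈ Finset.range (n + 1), p j :=
    Finset.prod_pos fun j _ => by simp only [p]; split_ifs <;> positivity
  filter_upwards [ae_mem_limsup_atTop_iff μ hEmeas, ae_all_iff.2 fun k => (hE (k * L)).2]
    with ω h1 h2
  -- Lévy's conditional Borel–Cantelli lemma: the conditional probabilities are one positive
  -- constant, so their sum diverges.
  have h3 : ω ∈ limsup E atTop := by
    refine h1.2 ?_
    have h4 : ∀ k, (μ[(E (k + 1)).indicator (1 : Ω → ℝ) | 𝒢 k]) ω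
        = ∏ j ∈ Finset.range (n + 1), p j := h2
    simp only [h4, Finset.sum_const, Finset.card_range, nsmul_eq_mul]
    exact tendsto_natCast_atTop_atTop.atTop_mul_const hpos
  rw [mem_limsup_iff_frequently_mem, frequently_atTop] at h3
  refine frequently_atTop.2 fun K => ?_
  obtain ⟨k, hk, hkE⟩ := h3 (K + 1)
  obtain ⟨k, rfl⟩ : ∃ k', k = k' + 1 := ⟨k - 1, by omega⟩
  have hkE' : ∀ j < n + 1, ω ∈ C (k * L) j := hkE
  have hlast : D.explore (k * L + n) ω ∧ D.action (k * L + n) ω = a ∧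
      D.table (k * L + n) ω = b := by
    have := hkE' n (by omega)
    rwa [show C (k * L) n = _ from dif_neg (lt_irrefl _)] at this
  refine ⟨k * L + n, ?_, hlast.2.2, ?_, hlast.2.1⟩
  · have : k * 1 ≤ k * L := Nat.mul_le_mul_left k (by omega)
    omega
  · rw [D.state_eq_foldl hrun k ω (l := l) (by omega) (fun j hj => ?_) n le_rfl]
    · rw [List.take_length, hls]
    · have := hkE' j (by omega)
      rw [show C (k * L) j = _ from dif_pos hj] at this
      exact this.2

theorem updatedForever_of_frequently {α : ℝ} (hα : 0 < α) (hrate : ∀ t ω, D.rate t ω = α)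
    (h : ∀ b s a, ∀ᵐ ω ∂μ, ∃ᶠ t in atTop, D.Updated b s a t ω) : D.UpdatedForever := by
  filter_upwards [ae_all_iff.2 fun b => ae_all_iff.2 fun s => ae_all_iff.2 (h b s)]
    with ω hω b s a hsum
  refine hω b s a ?_
  filter_upwards [hsum.tendsto_atTop_zero.eventually (gt_mem_nhds hα)] with t ht hu
  rw [if_pos hu, hrate] at ht
  exact lt_irrefl _ ht

end DoubleQLearning

theorem corollary1 {U : ℕ} (N : Network U) (γ ε : ℝ) (hγ₀ : 0 ≤ γ) (hγ₁ : γ < 1)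
    (hε₀ : 0 ≤ ε) (hε₁ : ε ≤ 1) :
    ∃ Qstar : N.State → Fin U → ℝ,
      N.mdp.IsBellmanOptimal γ Qstar ∧
      (∀ Q : N.State → Fin U → ℝ, N.mdp.IsBellmanOptimal γ Q → Q = Qstar) ∧
      ∀ {Ω : Type*} [MeasurableSpace Ω] (μ : Measure Ω) [IsProbabilityMeasure μ]
        (D : DoubleQLearning N γ ε μ),
        (D.UpdatedForever → D.ConvergesTo Qstar) ∧
        (∀ (α : ℝ) (L : ℕ), 0 < α → 0 < ε → U < L →
          (∀ t ω, D.rate t ω = α) → D.FairTables → D.RunLength L →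
          D.UpdatedForever ∧ D.ConvergesTo Qstar) := by
  obtain ⟨Qs, hQs, huniq⟩ := existsUnique_bellman N.next N.reward hγ₀ hγ₁
  have hQs' := N.isBellmanOptimal_iff.2 hQs
  refine ⟨Qs, hQs', fun Q hQ => huniq Q (N.isBellmanOptimal_iff.1 hQ), fun μ _ D =>
    ⟨D.convergesTo_of_updatedForever hγ₀ hγ₁ hQs', fun α L hα hε hL hrate hfair hrun => ?_⟩⟩
  have h := D.updatedForever_of_frequently hα hrate (D.frequently_updated hε hL hfair hrun)
  exact ⟨h, D.convergesTo_of_updatedForever hγ₀ hγ₁ hQs' h⟩
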